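/- Let $G$ be a finite Abelian group, $G^+=G\setminus\{0\}$ and $g_0\in G$. The master corner polyhedron $P(G,g_0)\subset\mathbb{R}^{G^+}$ is the convex hull of the nonzero vectors $t=(t(g))_{g\in G^+}$ with nonnegative integer components that satisfy $\sum_{g\in G^+}t(g)g=g_0$ (for $g_0\neq 0$ the word "nonzero" is superfluous). A pair $(\pi,\pi_0)$ with $\pi\in\mathbb{R}^{G^+}$, $\pi_0\in\mathbb{R}$ is a facet of $P(G,g_0)$ if $\sum_{g\in G^+}\pi(g)x(g)\ge\pi_0$ for all $x\in P(G,g_0)$ and the points of $P(G,g_0)$ with $\sum_{g\in G^+}\pi(g)x(g)=\pi_0$ (the points that belong to, or are contained in, the facet) form a nonempty face whose dimension is one less than that of $P(G,g_0)$; the facet is nontrivial if this face is not one of the faces $\{x\in P(G,g_0): x(g)=0\}$, $g\in G^+$. For $t\in P(G,g_0)$ put $G_t=\{g\in G^+ : t(g)>0\}$. Let a vertex $t$ of $P(G,g_0)$ belong to a nontrivial facet $(\pi,\pi_0)$ of $P(G,g_0)$, let $u(g)$, $g\in G^+$, be integers with $0\le u(g)\le t(g)$, and suppose that $h=\sum_{g\in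 G^+}u(g)g$ lies in $G^+$, i.e. $h\ne 0$. Then: (i) the point $w$ with components $w(g)=t(g)-u(g)$ for $g\in G^+$, $g\neq h$, and $w(h)=t(h)-u(h)+1$ belongs to all nontrivial facets of $P(G,g_0)$ that contain $t$; moreover $w(h)=t(h)+1$, except when $u$ is the unit vector at $h$ (that is, $u(h)=1$ and $u(g)=0$ for $g\neq h$), in which case $w=t$; (ii) $\pi(h)=\sum_{g\in G_t}u(g)\pi(g)$. -/

import Mathlib

/-- `G⁺ = G \ {0}`, the index set of the coordinates. -/
abbrev NonzeroElt (G : Type*) [Zero G] : Type _ := {g : G // g ≠ 0}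

/-- The nonnegative integer solutions `t = (t(g), g ∈ G⁺)` of the group equation
`∑ t(g) g = g₀`, viewed as points of `ℝ^(G⁺)`. The zero vector is left out; it solves the
equation only when `g₀ = 0`, and there it is excluded by convention. -/
def groupSolutions {G : Type*} [AddCommGroup G] [Fintype G] [DecidableEq G] (g₀ : G) :
    Set (NonzeroElt G → ℝ) :=
  {x | ∃ n : NonzeroElt G → ℕ,
    n ≠ 0 ∧ ∑ g, n g • (g : G) = g₀ ∧ x = fun g => (n g : ℝ)}

/-- The master corner polyhedron `P(G, g₀)`. -/
def masterCornerPolyhedron {G : Type*} [AddCommGroup G] [Fintype G] [DecidableEq G] (g₀ : G) :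
    Set (NonzeroElt G → ℝ) :=
  convexHull ℝ (groupSolutions g₀)

/-- `V(G, g₀)`, the vertices of the master corner polyhedron. -/
def cornerVertices {G : Type*} [AddCommGroup G] [Fintype G] [DecidableEq G] (g₀ : G) :
    Set (NonzeroElt G → ℝ) :=
  (masterCornerPolyhedron g₀).extremePoints ℝ

/-- `G_t = {g ∈ G⁺ | t(g) > 0}`. -/
noncomputable def positiveSupport {G : Type*} [AddCommGroup G] [Fintype G] [DecidableEq G]
    (t : NonzeroElt G → ℝ) : Finset (NonzeroElt G) :=
  {g | 0 < t g}

/-- The points of `P(G, g₀)` at which the inequality `∑ π(g) t(g) ≥ π₀` holds with equality. -/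
def cornerFace {G : Type*} [AddCommGroup G] [Fintype G] [DecidableEq G] (g₀ : G)
    (π : NonzeroElt G → ℝ) (π₀ : ℝ) : Set (NonzeroElt G → ℝ) :=
  {x | x ∈ masterCornerPolyhedron g₀ ∧ ∑ g, π g * x g = π₀}

/-- `(π, π₀)` is a facet of `P(G, g₀)`: the inequality `∑ π(g) t(g) ≥ π₀` is valid on the
polyhedron, and the face on which it is tight is nonempty of dimension one less than
the dimension of the polyhedron. -/
structure IsCornerFacet {G : Type*} [AddCommGroup G] [Fintype G] [DecidableEq G] (g₀ : G)
    (π : NonzeroElt G → ℝ) (π₀ : ℝ) : Prop where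
  valid : ∀ x ∈ masterCornerPolyhedron g₀, π₀ ≤ ∑ g, π g * x g
  nonempty : (cornerFace g₀ π π₀).Nonempty
  dim : Module.finrank ℝ (vectorSpan ℝ (cornerFace g₀ π π₀)) + 1 =
    Module.finrank ℝ (vectorSpan ℝ (masterCornerPolyhedron g₀))

/-- A facet is nontrivial if it is not one of the trivial facets, those defined by an
inequality `t(g) ≥ 0` with `g ∈ G⁺`. -/
structure IsNontrivialCornerFacet {G : Type*} [AddCommGroup G] [Fintype G] [DecidableEq G]
    (g₀ : G) (π : NonzeroElt G → ℝ) (π₀ : ℝ) : Prop extends IsCornerFacet g₀ π π₀ where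
  nontrivial : ∀ g : NonzeroElt G, cornerFace g₀ π π₀ ≠ cornerFace g₀ (Pi.single g 1) 0

/-!
The point `w` arises from the vertex `t` by exchanging the elements counted by `u` for a single
copy of their sum `h`, so it is again a nonnegative integer solution of the group equation.
Validity of a facet inequality `(ρ, ρ₀)` at `w` gives `∑ u(g) ρ(g) ≤ ρ(h)` whenever `t` lies on the
facet. The reverse inequality `ρ(h) ≤ ∑ u(g) ρ(g)` is subadditivity of nontrivial facets
(`IsNontrivialCornerFacet.le_sum_of_sum_eq`): exchanging every copy of `h` in an arbitrary solution
for `u` shows that the inequality `ρ₀ + (ρ(h) - ∑ u(g) ρ(g)) x(h) ≤ ∑ ρ(g) x(g)` is valid on the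
polyhedron, and a nontrivial facet has a point with `x(h) > 0`. The latter holds because the face
`x(h) = 0` is proper, so by dimension a facet inside it would coincide with it
(`IsNontrivialCornerFacet.exists_pos`). Equality of the two sides gives `ρ · w = ρ₀` and
the formula for `π(h)`.

For the value of `w` at `h`: if `u(h) > 0` and `u` is not the unit vector `e` at `h`, then
`d = u - e` is a nonzero nonnegative vector of group sum zero with `d ≤ t`, `d ≠ t`, and `t` is the
midpoint of the solutions `t - d` and `t + d`, so it is not a vertex
(`eq_zero_of_sum_eq_zero_of_mem_cornerVertices`).
-/

section

variable {G : Type*} [AddCommGroup G] [Fintype G] [DecidableEq G] {g₀ : G}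

theorem groupSolutions_subset_masterCornerPolyhedron :
    groupSolutions g₀ ⊆ masterCornerPolyhedron g₀ :=
  subset_convexHull ℝ _

theorem natCast_mem_groupSolutions {n : NonzeroElt G → ℕ} (hn : n ≠ 0)
    (hsum : ∑ g, n g • (g : G) = g₀) : (fun g => (n g : ℝ)) ∈ groupSolutions g₀ :=
  ⟨n, hn, hsum, rfl⟩

/-- A linear inequality holds on the whole polyhedron as soon as it holds at the solutions. -/
theorem le_sum_mul_of_forall_groupSolutions {a : NonzeroElt G → ℝ} {b : ℝ}
    (hs : ∀ x ∈ groupSolutions g₀, b ≤ ∑ g, a g * x g) {x : NonzeroElt G → ℝ}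
    (hx : x ∈ masterCornerPolyhedron g₀) : b ≤ ∑ g, a g * x g := by
  have hlin : IsLinearMap ℝ fun x : NonzeroElt G → ℝ => ∑ g, a g * x g :=
    { map_add := fun x y => by simp [mul_add, Finset.sum_add_distrib]
      map_smul := fun c x => by
        simp only [Pi.smul_apply, smul_eq_mul, Finset.mul_sum]
        exact Finset.sum_congr rfl fun g _ => by ring }
  exact convexHull_min (t := {x : NonzeroElt G → ℝ | b ≤ ∑ g, a g * x g})
    hs (convex_halfSpace_ge hlin b) hx

theorem masterCornerPolyhedron_nonneg {x : NonzeroElt G → ℝ}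
    (hx : x ∈ masterCornerPolyhedron g₀) (h : NonzeroElt G) : 0 ≤ x h := by
  have := le_sum_mul_of_forall_groupSolutions (a := Pi.single h 1) (b := 0) ?_ hx
  · simpa [Pi.single_apply] using this
  · rintro _ ⟨n, -, -, rfl⟩
    simp [Pi.single_apply]

/-- Linear functionals constant on a set vanish on its direction space. -/
theorem sum_mul_eq_zero_of_mem_vectorSpan {s : Set (NonzeroElt G → ℝ)} {a : NonzeroElt G → ℝ}
    {b : ℝ} (hs : ∀ x ∈ s, ∑ g, a g * x g = b) {v : NonzeroElt G → ℝ}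
    (hv : v ∈ vectorSpan ℝ s) : ∑ g, a g * v g = 0 := by
  have hle : vectorSpan ℝ s ≤ LinearMap.ker (Fintype.linearCombination ℝ a) := by
    refine Submodule.span_le.2 ?_
    rintro _ ⟨x, hx, y, hy, rfl⟩
    have hxy := (hs x hx).trans (hs y hy).symm
    simp only [SetLike.mem_coe, LinearMap.mem_ker, Fintype.linearCombination_apply,
      vsub_eq_sub, Pi.sub_apply, smul_eq_mul, sub_mul, Finset.sum_sub_distrib]
    simpa only [mul_comm, sub_eq_zero] using hxy
  have := hle hv
  simpa only [LinearMap.mem_ker, Fintype.linearCombination_apply, smul_eq_mul, mul_comm]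
    using this

/-- The trivial face `x(h) = 0` is proper, and so has smaller dimension than a nonempty
polyhedron: adding `|G|` copies of `h` to a solution gives a solution with another value at `h`. -/
theorem vectorSpan_trivialFace_lt (hP : (masterCornerPolyhedron g₀).Nonempty)
    (h : NonzeroElt G) :
    vectorSpan ℝ (cornerFace g₀ (Pi.single h 1) 0) < vectorSpan ℝ (masterCornerPolyhedron g₀) := by
  refine lt_of_le_of_ne (vectorSpan_mono ℝ fun x hx => hx.1) fun heq => ?_
  obtain ⟨_, n, hn, hsum, rfl⟩ := convexHull_nonempty_iff.1 hP
  have hm : (fun g => ((n + Pi.single h (Fintype.card G) : NonzeroElt G → ℕ) g : ℝ)) ∈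
      groupSolutions g₀ := by
    refine natCast_mem_groupSolutions (fun h0 => hn ?_) ?_
    · funext g
      have := congrFun h0 g
      simp only [Pi.add_apply, Pi.zero_apply] at this ⊢
      omega
    · simp [add_smul, hsum, Pi.single_apply]
  have hd := vsub_mem_vectorSpan ℝ
    (groupSolutions_subset_masterCornerPolyhedron hm)
    (groupSolutions_subset_masterCornerPolyhedron (natCast_mem_groupSolutions hn hsum))
  rw [← heq] at hd
  have h0 := sum_mul_eq_zero_of_mem_vectorSpan (fun x hx => hx.2) hd
  simp [Pi.single_apply] at h0

/-- A nontrivial facet is not contained in a trivial face `x(h) = 0`: the dimension of that face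
would force the two to coincide. -/
theorem IsNontrivialCornerFacet.exists_pos {ρ : NonzeroElt G → ℝ} {ρ₀ : ℝ}
    (hρ : IsNontrivialCornerFacet g₀ ρ ρ₀) (h : NonzeroElt G) :
    ∃ x ∈ cornerFace g₀ ρ ρ₀, 0 < x h := by
  by_contra! hcon
  have hsub : cornerFace g₀ ρ ρ₀ ⊆ cornerFace g₀ (Pi.single h 1) 0 := fun x hx =>
    ⟨hx.1, by
      simpa [Pi.single_apply] using
        le_antisymm (hcon x hx) (masterCornerPolyhedron_nonneg hx.1 h)⟩
  obtain ⟨p, hp⟩ := hρ.nonempty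
  have hlt := Submodule.finrank_lt_finrank_of_lt (vectorSpan_trivialFace_lt ⟨p, hp.1⟩ h)
  have hspan : vectorSpan ℝ (cornerFace g₀ ρ ρ₀) =
      vectorSpan ℝ (cornerFace g₀ (Pi.single h 1) 0) :=
    Submodule.eq_of_le_of_finrank_le (vectorSpan_mono ℝ hsub) (by have := hρ.dim; omega)
  refine hρ.nontrivial h (hsub.antisymm fun x hx => ⟨hx.1, ?_⟩)
  have hd := vsub_mem_vectorSpan ℝ hx (hsub hp)
  rw [← hspan] at hd
  have h0 := sum_mul_eq_zero_of_mem_vectorSpan (fun x hx => hx.2) hd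
  simp only [vsub_eq_sub, Pi.sub_apply, mul_sub, Finset.sum_sub_distrib] at h0
  linarith [hp.2]

/-- Subadditivity of nontrivial facets. -/
theorem IsNontrivialCornerFacet.le_sum_of_sum_eq {ρ : NonzeroElt G → ℝ} {ρ₀ : ℝ}
    (hρ : IsNontrivialCornerFacet g₀ ρ ρ₀) {u : NonzeroElt G → ℕ} {h : NonzeroElt G}
    (hu : ∑ g, u g • (g : G) = h) : ρ h ≤ ∑ g, ρ g * u g := by
  set c := ∑ g, ρ g * (u g : ℝ) with hc
  have hu0 : u ≠ 0 := by
    rintro rfl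
    exact h.2 (by simpa using hu.symm)
  have hvalid : ∀ x ∈ groupSolutions g₀,
      ρ₀ ≤ ∑ g, (ρ - Pi.single h (ρ h - c) : NonzeroElt G → ℝ) g * x g := by
    rintro _ ⟨n, hn, hsum, rfl⟩
    -- `m` is `n` with each of its `n h` copies of `h` exchanged for `u`.
    set m : NonzeroElt G → ℕ := Function.update n h 0 + n h • u with hm
    have hn' : n = Function.update n h 0 + Pi.single h (n h) := by
      funext g
      by_cases hg : g = h
      · subst hg; simp
      · simp [hg]
    have hm0 : m ≠ 0 := by
      intro h0
      by_cases hnh : n h = 0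
      · apply hn
        rw [hm, hnh, zero_smul, add_zero] at h0
        rw [hn', h0, hnh, Pi.single_zero, add_zero]
      · apply hu0
        funext g
        have := congrFun h0 g
        simp only [hm, Pi.add_apply, Pi.smul_apply, Pi.zero_apply, smul_eq_mul,
          Nat.add_eq_zero_iff, mul_eq_zero] at this
        exact this.2.resolve_left hnh
    have hmsum : ∑ g, m g • (g : G) = g₀ := by
      rw [← hsum]
      conv_rhs => rw [hn']
      simp only [hm, Pi.add_apply, Pi.smul_apply, smul_eq_mul, add_smul, mul_smul,
        Finset.sum_add_distrib, ← Finset.smul_sum, hu]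
      simp [Pi.single_apply]
    have hle := hρ.valid _
      (groupSolutions_subset_masterCornerPolyhedron (natCast_mem_groupSolutions hm0 hmsum))
    refine hle.trans_eq ?_
    have h1 : ∑ g, ρ g * (m g : ℝ) = ∑ g, ρ g * (Function.update n h 0 g : ℝ) + n h * c := by
      rw [hc, Finset.mul_sum, ← Finset.sum_add_distrib]
      refine Finset.sum_congr rfl fun g _ => ?_
      simp only [hm, Pi.add_apply, Pi.smul_apply, smul_eq_mul]
      push_cast
      ring
    have h2 : ∑ g, ρ g * (n g : ℝ) = ∑ g, ρ g * (Function.update n h 0 g : ℝ) + n h * ρ h := by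
      conv_lhs => rw [hn']
      simp [Pi.single_apply, mul_add, Finset.sum_add_distrib, mul_comm]
    have h3 : ∑ g, (ρ - Pi.single h (ρ h - c) : NonzeroElt G → ℝ) g * (n g : ℝ) =
        ∑ g, ρ g * (n g : ℝ) - (ρ h - c) * n h := by
      simp [Pi.single_apply, sub_mul, Finset.sum_sub_distrib]
    rw [h1, h3, h2]
    ring
  obtain ⟨x, hx, hxh⟩ := hρ.exists_pos h
  have hle := le_sum_mul_of_forall_groupSolutions hvalid hx.1
  have h3 : ∑ g, (ρ - Pi.single h (ρ h - c) : NonzeroElt G → ℝ) g * x g =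
      ρ₀ - (ρ h - c) * x h := by
    rw [← hx.2]
    simp [Pi.single_apply, sub_mul, Finset.sum_sub_distrib]
  rw [h3] at hle
  by_contra! hlt
  nlinarith [mul_pos (sub_pos.2 hlt) hxh]

/-- A vertex dominates no nonzero integer vector of group sum zero, except possibly itself. The
exception occurs only for `g₀ = 0`, where the origin is left out of the solutions. -/
theorem eq_zero_of_sum_eq_zero_of_mem_cornerVertices {n d : NonzeroElt G → ℕ}
    (hn : (fun g => (n g : ℝ)) ∈ cornerVertices g₀) (hsum : ∑ g, n g • (g : G) = g₀)
    (hd : ∑ g, d g • (g : G) = 0) (hle : d ≤ n) (hne : d ≠ n) : d = 0 := by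
  have hsplit : n - d + d = n := tsub_add_cancel_of_le hle
  have hminus : (fun g => ((n - d) g : ℝ)) ∈ groupSolutions g₀ := by
    refine natCast_mem_groupSolutions (fun h0 => hne ?_) ?_
    · rw [← hsplit, h0, zero_add]
    · rw [← hsum]
      conv_rhs => rw [← hsplit]
      simp only [Pi.add_apply, add_smul, Finset.sum_add_distrib, hd, add_zero]
  have hplus : (fun g => ((n + d) g : ℝ)) ∈ groupSolutions g₀ := by
    refine natCast_mem_groupSolutions (fun h0 => hne ?_) ?_
    · funext g
      have := congrFun h0 g
      simp only [Pi.add_apply, Pi.zero_apply] at this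
      omega
    · simp [add_smul, Finset.sum_add_distrib, hd, hsum]
  have hmid : (fun g => (n g : ℝ)) ∈
      openSegment ℝ (fun g => ((n - d) g : ℝ)) (fun g => ((n + d) g : ℝ)) := by
    refine ⟨1 / 2, 1 / 2, by norm_num, by norm_num, by norm_num, ?_⟩
    funext g
    simp only [Pi.add_apply, Pi.smul_apply, Pi.sub_apply, smul_eq_mul, Nat.cast_sub (hle g),
      Nat.cast_add]
    ring
  have heq := hn.2 (groupSolutions_subset_masterCornerPolyhedron hminus)
    (groupSolutions_subset_masterCornerPolyhedron hplus) hmid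
  funext g
  have h1 : n g - d g = n g := by exact_mod_cast congrFun heq g
  have h2 : d g ≤ n g := hle g
  simp only [Pi.zero_apply]
  omega

/-- The exchange of `u` for `h` keeps a solution on every nontrivial facet through it, and the
subadditivity relation for `u` is tight on such a facet. -/
theorem IsNontrivialCornerFacet.exchange {ρ : NonzeroElt G → ℝ} {ρ₀ : ℝ}
    (hρ : IsNontrivialCornerFacet g₀ ρ ρ₀) {n u : NonzeroElt G → ℕ} {h : NonzeroElt G}
    (hsum : ∑ g, n g • (g : G) = g₀) (hle : u ≤ n) (hu : ∑ g, u g • (g : G) = h)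
    (hn : ∑ g, ρ g * (n g : ℝ) = ρ₀) :
    (fun g => ((n - u + Pi.single h 1 : NonzeroElt G → ℕ) g : ℝ)) ∈ cornerFace g₀ ρ ρ₀ ∧
      ρ h = ∑ g, ρ g * u g := by
  have hmem : (fun g => ((n - u + Pi.single h 1 : NonzeroElt G → ℕ) g : ℝ)) ∈
      groupSolutions g₀ := by
    refine natCast_mem_groupSolutions (fun h0 => ?_) ?_
    · simpa using congrFun h0 h
    · rw [← hsum]
      conv_rhs => rw [← tsub_add_cancel_of_le hle]
      simp only [Pi.add_apply, add_smul, Finset.sum_add_distrib, hu]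
      simp [Pi.single_apply]
  have hP := groupSolutions_subset_masterCornerPolyhedron hmem
  have hval : ∑ g, ρ g * ((n - u + Pi.single h 1 : NonzeroElt G → ℕ) g : ℝ) =
      ρ₀ - ∑ g, ρ g * u g + ρ h := by
    have hcast : ∀ g, (((n - u + Pi.single h 1 : NonzeroElt G → ℕ) g : ℕ) : ℝ) =
        n g - u g + if g = h then 1 else 0 := fun g => by
      simp [Nat.cast_sub (hle g), Pi.single_apply]
    simp only [hcast, ← hn, mul_add, mul_sub, Finset.sum_add_distrib, Finset.sum_sub_distrib]
    simp
  have hge := hρ.valid _ hP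
  have hsub := hρ.le_sum_of_sum_eq hu
  rw [hval] at hge
  have heq : ρ h = ∑ g, ρ g * u g := by linarith
  exact ⟨⟨hP, by rw [hval]; linarith⟩, heq⟩

end

theorem theorem2 {G : Type*} [AddCommGroup G] [Fintype G] [DecidableEq G] (g₀ : G)
    (π : NonzeroElt G → ℝ) (π₀ : ℝ) (hπ : IsNontrivialCornerFacet g₀ π π₀)
    (t : NonzeroElt G → ℝ) (ht : t ∈ cornerVertices g₀) (htπ : t ∈ cornerFace g₀ π π₀)
    (u : NonzeroElt G → ℤ) (hu_nonneg : ∀ g, 0 ≤ u g) (hu_le : ∀ g, (u g : ℝ) ≤ t g)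
    (h : NonzeroElt G) (hh : (h : G) = ∑ g, u g • (g : G))
    (w : NonzeroElt G → ℝ)
    (hw : ∀ g, w g = if g = h then t g - u g + 1 else t g - u g) :
    ((∀ (ρ : NonzeroElt G → ℝ) (ρ₀ : ℝ), IsNontrivialCornerFacet g₀ ρ ρ₀ →
        t ∈ cornerFace g₀ ρ ρ₀ → w ∈ cornerFace g₀ ρ ρ₀) ∧
      (u ≠ Pi.single h 1 → w h = t h + 1)) ∧
    π h = ∑ g ∈ positiveSupport t, (u g : ℝ) * π g := by
  obtain ⟨n, hn, hsum, rfl⟩ := extremePoints_convexHull_subset ht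
  lift u to NonzeroElt G → ℕ using hu_nonneg
  simp only [Int.cast_natCast, natCast_zsmul] at hu_le hh hw ⊢
  have hle : u ≤ n := fun g => by exact_mod_cast hu_le g
  have hwn : w = fun g => ((n - u + Pi.single h 1 : NonzeroElt G → ℕ) g : ℝ) := by
    funext g
    rw [hw]
    by_cases hg : g = h
    · subst hg; simp [Nat.cast_sub (hle g)]
    · simp [hg, Nat.cast_sub (hle g)]
  refine ⟨⟨fun ρ ρ₀ hρ htρ => ?_, fun hne => ?_⟩, ?_⟩
  · rw [hwn]
    exact (hρ.exchange hsum hle hh.symm htρ.2).1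
  · suffices hu0 : u h = 0 by simp [hw, hu0]
    by_contra hpos
    have hsplit : u - Pi.single h 1 + Pi.single h 1 = u :=
      tsub_add_cancel_of_le (by
        intro g
        by_cases hg : g = h
        · subst hg; simp; omega
        · simp [hg])
    have hd : ∑ g, (u - Pi.single h 1 : NonzeroElt G → ℕ) g • (g : G) = 0 := by
      rw [← hsplit] at hh
      simp only [Pi.add_apply, add_smul, Finset.sum_add_distrib] at hh
      simpa [Pi.single_apply] using hh
    -- `u - Pi.single h 1` is smaller than `n` at `h`, hence different from `n`.
    have h0 := eq_zero_of_sum_eq_zero_of_mem_cornerVertices ht hsum hd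
      (tsub_le_self.trans hle) (fun heq => by
        have h1 := congrFun heq h
        have h2 : u h ≤ n h := hle h
        rw [Pi.sub_apply, Pi.single_eq_same] at h1
        omega)
    rw [h0, zero_add] at hsplit
    apply hne
    funext g
    rw [← hsplit]
    by_cases hg : g = h
    · subst hg; simp
    · simp [hg]
  · rw [(hπ.exchange hsum hle hh.symm htπ.2).2]
    symm
    -- Off the support of `t` the inequalities `0 ≤ u ≤ t` force `u` to vanish.
    have hext : ∑ g ∈ positiveSupport fun g => (n g : ℝ), (u g : ℝ) * π g =
        ∑ g, (u g : ℝ) * π g := by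
      refine Finset.sum_subset (Finset.subset_univ _) fun g _ hg => ?_
      have hg0 : n g = 0 := by simpa [positiveSupport] using hg
      have : u g = 0 := Nat.le_zero.1 (hg0 ▸ hle g)
      simp [this]
    rw [hext]
    exact Finset.sum_congr rfl fun g _ => mul_comm _ _
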